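/- All graphs are finite, simple and undirected. Let $G$ be a graph with shortest-path distance $d_G$. An isometric path of $G$ is a path of $G$ that is a shortest path between its end-vertices; it is $v$-rooted if $v$ is one of its end-vertices. The strong isometric path complexity of a connected graph $G$ is the minimum integer $k$ such that for every vertex $v$ of $G$ and every isometric path $P$ of $G$, the vertices of $P$ can be covered by at most $k$ $v$-rooted isometric paths of $G$. A class $\mathcal G$ of connected graphs has bounded strong isometric path complexity if there is an integer $k$ such that every $G\in\mathcal G$ has strong isometric path complexity at most $k$. For an integer $K\ge 1$, a $K$-fat minor model of a graph $H$ in $G$ consists of non-empty connected subgraphs $B_v$ ($v\in V(H)$) and $P_e$ ($e\in E(H)$) of $G$ such that $V(B_v)\cap V(P_e)\neq\emptyset$ whenever $v$ is an end-vertex of $e$, and any two distinct members of the family that do not form such an incident pair are at distance at least $K$ in $G$ (where $d_G(X,Y)=\min\{d_G(x,y): x\in V(X),\,y\in V(Y)\}$). A class $\mathcal G$ of graphs is $H$-asymptotic minor-free if there is an integer $K\ge 1$ such that no graph in $\mathcal G$ contains a $K$-fat minor model of $H$. **Corollary.** Let $H$ be a graph with at most four vertices. Then the following are equivalent: 1.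 every $H$-asymptotic minor-free class of connected graphs has bounded strong isometric path complexity (with a bound that may depend on the class); 2. $H$ is not isomorphic to $K_4$. -/

import Mathlib

universe u v

namespace CoarseGraph

section Paths

variable {V : Type u} {G : SimpleGraph V}

/-- An isometric path: a path which is a shortest path between its two end-vertices. -/
def IsIsometric {a b : V} (p : G.Walk a b) : Prop :=
  p.IsPath ∧ p.length = G.dist a b

/-- The vertices of the path `p` can be covered by `k` many `r`-rooted isometric paths, that is,
isometric paths with `r` as an end-vertex. (Repetitions are allowed in the family `q`, so this says
that at most `k` such paths are enough.) -/
def IsCoverableFrom (r : V) (k : ℕ) {a b : V} (p : G.Walk a b) : Prop :=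
  ∃ (e : Fin k → V) (q : ∀ i, G.Walk r (e i)),
    (∀ i, IsIsometric (q i)) ∧ ∀ x ∈ p.support, ∃ i, x ∈ (q i).support

/-- For every vertex `r`, the vertices of any isometric path of `G` can be covered by `k` many
`r`-rooted isometric paths. -/
def StronglyCoverable (G : SimpleGraph V) (k : ℕ) : Prop :=
  ∀ (r a b : V) (p : G.Walk a b), IsIsometric p → IsCoverableFrom r k p

/-- The strong isometric path complexity of a (connected) graph: the minimum `k` such that for every
vertex `r`, the vertices of any isometric path can be covered by `k` many `r`-rooted isometric
paths. The value is taken in `ℕ∞`, and is `⊤` if there is no such `k`. -/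
noncomputable def strongIsometricPathComplexity (G : SimpleGraph V) : ℕ∞ :=
  ⨅ (k : ℕ) (_ : StronglyCoverable G k), (k : ℕ∞)

end Paths

/-- The distance between two sets of vertices of `G`. It is `⊤` if there is no path in `G` between
the two sets. -/
noncomputable def setDist {V : Type u} (G : SimpleGraph V) (S T : Set V) : ℕ∞ :=
  ⨅ x ∈ S, ⨅ y ∈ T, G.edist x y

/-- A `K`-fat minor model of `H` in `G`. `SimpleGraph.Subgraph.Connected` includes that the subgraph
has at least one vertex. -/
structure FatMinorModel {V : Type u} {W : Type v} (K : ℕ) (H : SimpleGraph W)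
    (G : SimpleGraph V) where
  /-- the branch sets -/
  branchSet : W → G.Subgraph
  /-- the branch paths -/
  branchPath : H.edgeSet → G.Subgraph
  branchSet_connected : ∀ w, (branchSet w).Connected
  branchPath_connected : ∀ e, (branchPath e).Connected
  incident : ∀ (w : W) (e : H.edgeSet), w ∈ (e : Sym2 W) →
    ((branchSet w).verts ∩ (branchPath e).verts).Nonempty
  far_set_set : ∀ w w' : W, w ≠ w' →
    (K : ℕ∞) ≤ setDist G (branchSet w).verts (branchSet w').verts
  far_path_path : ∀ e e' : H.edgeSet, e ≠ e' →
    (K : ℕ∞) ≤ setDist G (branchPath e).verts (branchPath e').verts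
  far_set_path : ∀ (w : W) (e : H.edgeSet), w ∉ (e : Sym2 W) →
    (K : ℕ∞) ≤ setDist G (branchSet w).verts (branchPath e).verts

/-- `H` is a `K`-fat minor of `G`. -/
def IsFatMinor {V : Type u} {W : Type v} (K : ℕ) (H : SimpleGraph W) (G : SimpleGraph V) : Prop :=
  Nonempty (FatMinorModel K H G)

/-- A finite simple graph. A class of graphs is a `Set FinGraph`. -/
structure FinGraph where
  /-- the vertex type -/
  V : Type u
  /-- there are finitely many vertices -/
  finite : Finite V
  /-- the graph -/
  graph : SimpleGraph V

/-- The class `𝒢` contains `H` as an asymptotic minor. -/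
def HasAsymptoticMinor {W : Type v} (H : SimpleGraph W) (𝒢 : Set FinGraph.{u}) : Prop :=
  ∀ K : ℕ, 1 ≤ K → ∃ G ∈ 𝒢, IsFatMinor K H G.graph

/-- The class `𝒢` is `H`-asymptotic minor-free. -/
def IsAsymptoticMinorFree {W : Type v} (H : SimpleGraph W) (𝒢 : Set FinGraph.{u}) : Prop :=
  ¬ HasAsymptoticMinor H 𝒢

/-- The class `𝒢` has bounded strong isometric path complexity. -/
def HasBoundedStrongIsometricPathComplexity (𝒢 : Set FinGraph.{u}) : Prop :=
  ∃ k : ℕ, ∀ G ∈ 𝒢, strongIsometricPathComplexity G.graph ≤ (k : ℕ∞)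

end CoarseGraph

namespace CoarseGraph

open SimpleGraph

/-! ### Greedy covering of a path, and defects. -/

section Covering

variable {V : Type u} {G : SimpleGraph V}

/-! A graph on at most four vertices other than K₄ embeds in the diamond, K₄ minus an edge, so the
positive direction concerns graphs without a K-fat diamond minor. Cut an isometric path P greedily
into blocks, each inside one r-rooted isometric path (`cover_or_defects`). If many blocks are
needed, the distance to r lags behind the index along P, by at least 1 per block (`defects_add`).
Take three vertices of P many blocks apart. A shortest path from r to each of them first comes near
P at a place (`exists_leg`) that the defects keep within few blocks of its target, so the three
places are far apart. The initial parts of these shortest paths form a hub far from P, and together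
with P they give a K-fat diamond (`isFatMinor_diamond`).

For K₄ the counterexamples are subdivided fans: a path on n + 1 vertices, each joined to a centre by
a path of length n + 1. The base path is isometric and equidistant from the centre, so it needs n +
1 rooted paths. Deleting the centre leaves a forest, whereas a 2-fat K₄ model keeps a fat triangle
avoiding any given vertex, which is impossible in a forest (`not_fat_triangle`). -/

theorem exists_walk_segment {a b : V} (p : G.Walk a b) {s t : ℕ} (hst : s ≤ t)
    (ht : t ≤ p.length) :
    ∃ q : G.Walk (p.getVert s) (p.getVert t), q.length = t - s ∧
      ∀ x, x ∈ q.support ↔ ∃ i, s ≤ i ∧ i ≤ t ∧ p.getVert i = x := by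
  induction t, hst using Nat.le_induction with
  | base =>
    refine ⟨.nil, by simp, fun x => ?_⟩
    simp only [Walk.support_nil, List.mem_singleton]
    constructor
    · rintro rfl
      exact ⟨s, le_rfl, le_rfl, rfl⟩
    · rintro ⟨i, h1, h2, rfl⟩
      rw [le_antisymm h2 h1]
  | succ t hst ih =>
    obtain ⟨q, hq, hs⟩ := ih (by omega)
    refine ⟨q.concat (p.adj_getVert_succ (by omega)), by rw [Walk.length_concat]; omega,
      fun x => ?_⟩
    rw [Walk.support_concat, List.mem_append, List.mem_singleton, hs]
    constructor
    · rintro (⟨i, h1, h2, rfl⟩ | rfl)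
      · exact ⟨i, h1, by omega, rfl⟩
      · exact ⟨t + 1, by omega, le_rfl, rfl⟩
    · rintro ⟨i, h1, h2, rfl⟩
      rcases Nat.lt_or_ge t i with h | h
      · right
        rw [show i = t + 1 by omega]
      · exact Or.inl ⟨i, h1, h, rfl⟩

theorem dist_getVert_le {a b : V} (p : G.Walk a b) {s t : ℕ} (hst : s ≤ t) (ht : t ≤ p.length) :
    G.dist (p.getVert s) (p.getVert t) ≤ t - s := by
  obtain ⟨q, hq, -⟩ := exists_walk_segment p hst ht
  exact hq ▸ dist_le q

theorem IsIsometric.dist_getVert (hG : G.Connected) {a b : V} {p : G.Walk a b}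
    (hp : IsIsometric p) {s t : ℕ} (hst : s ≤ t) (ht : t ≤ p.length) :
    G.dist (p.getVert s) (p.getVert t) = t - s := by
  have h1 := dist_getVert_le p hst ht
  have h2 := dist_getVert_le p (Nat.zero_le s) (hst.trans ht)
  have h3 := dist_getVert_le p ht le_rfl
  rw [Walk.getVert_zero] at h2
  rw [Walk.getVert_length] at h3
  have h4 := hG.dist_triangle (u := a) (v := p.getVert s) (w := b)
  have h5 := hG.dist_triangle (u := p.getVert s) (v := p.getVert t) (w := b)
  have h6 := hp.2
  omega

theorem isIsometric_of_length_le {a b : V} (p : G.Walk a b) (h : p.length ≤ G.dist a b) :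
    IsIsometric p := by
  have h' : p.length = G.dist a b := le_antisymm h (dist_le p)
  exact ⟨p.isPath_of_length_eq_dist h', h'⟩

/-- The set `S` is contained in a single isometric path with end-vertex `r`. -/
def IsRootedSet (G : SimpleGraph V) (r : V) (S : Set V) : Prop :=
  ∃ (e : V) (q : G.Walk r e), IsIsometric q ∧ ∀ x ∈ S, x ∈ q.support

/-- The vertices of a walk with indices from `s` to `t`. -/
def segment {a b : V} (p : G.Walk a b) (s t : ℕ) : Set V :=
  {x | ∃ i, s ≤ i ∧ i ≤ t ∧ p.getVert i = x}

/-- A shortest path from `r` to the nearer end, continued along the segment, is no longer than the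
distance from `r` to the farther end. -/
theorem isRootedSet_segment (hG : G.Connected) (r : V) {a b : V} (p : G.Walk a b) {s t : ℕ}
    (hst : s ≤ t) (ht : t ≤ p.length)
    (h : G.dist r (p.getVert s) + (t - s) ≤ G.dist r (p.getVert t) ∨
      G.dist r (p.getVert t) + (t - s) ≤ G.dist r (p.getVert s)) :
    IsRootedSet G r (segment p s t) := by
  obtain ⟨q, hq, hs⟩ := exists_walk_segment p hst ht
  rcases h with h | h
  · obtain ⟨w, hw⟩ := hG.exists_walk_length_eq_dist r (p.getVert s)
    refine ⟨_, w.append q, isIsometric_of_length_le _ (by rw [Walk.length_append]; omega),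
      fun x hx => ?_⟩
    rw [Walk.mem_support_append_iff]
    exact Or.inr ((hs x).2 hx)
  · obtain ⟨w, hw⟩ := hG.exists_walk_length_eq_dist r (p.getVert t)
    refine ⟨_, w.append q.reverse, isIsometric_of_length_le _
      (by rw [Walk.length_append, Walk.length_reverse]; omega), fun x hx => ?_⟩
    rw [Walk.mem_support_append_iff, Walk.support_reverse, List.mem_reverse]
    exact Or.inr ((hs x).2 hx)

/-- The distance to `r` changes by less than the number of steps between the indices `s` and `t`
of the walk `p`: neither of the two vertices is on a shortest path between `r` and the other one
that follows `p`. -/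
def HasDefect (r : V) {a b : V} (p : G.Walk a b) (s t : ℕ) : Prop :=
  (G.dist r (p.getVert t) : ℤ) - G.dist r (p.getVert s) < t - s ∧
    (G.dist r (p.getVert s) : ℤ) - G.dist r (p.getVert t) < t - s

theorem isRootedSet_segment_of_not_hasDefect (hG : G.Connected) (r : V) {a b : V}
    (p : G.Walk a b) {s t : ℕ} (hst : s ≤ t) (ht : t ≤ p.length) (h : ¬ HasDefect r p s t) :
    IsRootedSet G r (segment p s t) := by
  apply isRootedSet_segment hG r p hst ht
  unfold HasDefect at h
  omega

/-- Either the final part of a walk is covered by `m` rooted isometric paths, or it contains a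
sequence of `m` consecutive defects. -/
theorem cover_or_defects (hG : G.Connected) (r : V) {a b : V} (p : G.Walk a b) (m : ℕ) :
    ∀ s ≤ p.length,
      (∃ T : Fin m → Set V, (∀ i, IsRootedSet G r (T i)) ∧
        ∀ y ∈ segment p s p.length, ∃ i, y ∈ T i) ∨
      ∃ x : ℕ → ℕ, x 0 = s ∧ x m ≤ p.length ∧ ∀ i < m, HasDefect r p (x i) (x (i + 1)) := by
  induction m with
  | zero =>
    intro s hs
    exact Or.inr ⟨fun _ => s, rfl, hs, by simp⟩
  | succ m ih =>
    intro s hs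
    by_cases hj : ∃ j, s < j ∧ j ≤ p.length ∧ HasDefect r p s j
    · classical
      obtain ⟨h1, h2, h3⟩ := Nat.find_spec hj
      have hmin := fun k hk => Nat.find_min hj (m := k) hk
      set j := Nat.find hj
      rcases ih j h2 with ⟨T, hT, hc⟩ | ⟨x, hx0, hxm, hx⟩
      · left
        have h0 : IsRootedSet G r (segment p s (j - 1)) := by
          apply isRootedSet_segment_of_not_hasDefect hG r p (by omega) (by omega)
          -- Minimality of `j` excludes a defect at `j - 1`; if `j - 1 = s`, a defect would read `0
          -- < 0`.
          intro hd
          have hlt : s < j - 1 := by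
            unfold HasDefect at hd
            omega
          exact hmin (j - 1) (by omega) ⟨hlt, by omega, hd⟩
        refine ⟨Fin.cons (segment p s (j - 1)) T, fun i => ?_, ?_⟩
        · refine Fin.cases ?_ (fun i => ?_) i
          · simpa using h0
          · simpa using hT i
        · rintro y ⟨i, hi1, hi2, rfl⟩
          rcases Nat.lt_or_ge i j with hij | hij
          · exact ⟨0, by simpa using ⟨i, hi1, by omega, rfl⟩⟩
          · obtain ⟨l, hl⟩ := hc _ ⟨i, hij, hi2, rfl⟩
            exact ⟨l.succ, by simpa using hl⟩
      · right
        refine ⟨fun i => Nat.casesOn i s x, rfl, hxm, fun i hi => ?_⟩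
        cases i with
        | zero => simpa [hx0] using h3
        | succ i => exact hx i (by omega)
    · left
      refine ⟨fun _ => segment p s p.length, fun _ => ?_, fun y hy => ⟨0, hy⟩⟩
      apply isRootedSet_segment_of_not_hasDefect hG r p hs le_rfl
      intro hd
      refine hj ⟨p.length, ?_, le_rfl, hd⟩
      unfold HasDefect at hd
      omega

theorem isCoverableFrom_or_defects (hG : G.Connected) (r : V) {a b : V} (p : G.Walk a b) (m : ℕ) :
    IsCoverableFrom r m p ∨
      ∃ x : ℕ → ℕ, x m ≤ p.length ∧ ∀ i < m, HasDefect r p (x i) (x (i + 1)) := by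
  rcases cover_or_defects hG r p m 0 (Nat.zero_le _) with ⟨T, hT, hc⟩ | ⟨x, -, hxm, hx⟩
  · left
    choose e q hq hTq using hT
    refine ⟨e, q, hq, fun y hy => ?_⟩
    obtain ⟨n, rfl, hn⟩ := Walk.mem_support_iff_exists_getVert.1 hy
    obtain ⟨i, hi⟩ := hc _ ⟨n, Nat.zero_le n, hn, rfl⟩
    exact ⟨i, hTq i _ hi⟩
  · exact Or.inr ⟨x, hxm, hx⟩

/-- Distances are integers, so each strict inequality of a defect loses at least 1, and the losses
add up. -/
theorem defects_add {r a b : V} {p : G.Walk a b} {x : ℕ → ℕ} {m : ℕ}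
    (hx : ∀ i < m, HasDefect r p (x i) (x (i + 1))) {i j : ℕ} (hij : i ≤ j) (hj : j ≤ m) :
    (G.dist r (p.getVert (x j)) : ℤ) - G.dist r (p.getVert (x i)) ≤ x j - x i - (j - i) ∧
      (G.dist r (p.getVert (x i)) : ℤ) - G.dist r (p.getVert (x j)) ≤ x j - x i - (j - i) := by
  induction j, hij using Nat.le_induction with
  | base => simp
  | succ j hij ih =>
    have h1 := ih (by omega)
    have h2 := hx j (by omega)
    unfold HasDefect at h2
    push_cast
    omega

end Covering

/-! ### Fat models of the diamond built along an isometric path. -/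

section FatDiamond

variable {V : Type u} {G : SimpleGraph V}

theorem le_setDist (hG : G.Connected) {K : ℕ} {S T : Set V}
    (h : ∀ x ∈ S, ∀ y ∈ T, K ≤ G.dist x y) : (K : ℕ∞) ≤ setDist G S T := by
  refine le_iInf₂ fun x hx => le_iInf₂ fun y hy => ?_
  rw [← (hG.preconnected x y).coe_dist_eq_edist]
  exact_mod_cast h x hx y hy

theorem setDist_comm (S T : Set V) : setDist G S T = setDist G T S := by
  unfold setDist
  rw [iInf₂_comm]
  simp only [edist_comm]

/-- Every vertex of `X` is at distance at most `ρ` from a vertex of `p` with index between `lo` and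
`hi`. -/
def IsNear {a b : V} (p : G.Walk a b) (lo hi ρ : ℕ) (X : Set V) : Prop :=
  ∀ x ∈ X, ∃ i, lo ≤ i ∧ i ≤ hi ∧ i ≤ p.length ∧ G.dist x (p.getVert i) ≤ ρ

/-- On an isometric path index differences are distances, so separation of the index ranges survives
after subtracting both radii. -/
theorem IsNear.le_setDist_of_le (hG : G.Connected) {a b : V} {p : G.Walk a b} (hp : IsIsometric p)
    {K lo hi ρ lo' hi' ρ' : ℕ} {X Y : Set V} (hX : IsNear p lo hi ρ X)
    (hY : IsNear p lo' hi' ρ' Y) (h : hi + ρ + ρ' + K ≤ lo') :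
    (K : ℕ∞) ≤ setDist G X Y := by
  refine le_setDist hG fun x hx y hy => ?_
  obtain ⟨i, hi1, hi2, hi3, hi4⟩ := hX x hx
  obtain ⟨j, hj1, hj2, hj3, hj4⟩ := hY y hy
  have h1 := hp.dist_getVert hG (s := i) (t := j) (by omega) hj3
  have h2 := hG.dist_triangle (u := p.getVert i) (v := x) (w := p.getVert j)
  have h3 := hG.dist_triangle (u := x) (v := y) (w := p.getVert j)
  rw [dist_comm] at hi4
  omega

theorem IsNear.le_setDist (hG : G.Connected) {a b : V} {p : G.Walk a b} (hp : IsIsometric p)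
    {K lo hi ρ lo' hi' ρ' : ℕ} {X Y : Set V} (hX : IsNear p lo hi ρ X)
    (hY : IsNear p lo' hi' ρ' Y)
    (h : hi + ρ + ρ' + K ≤ lo' ∨ hi' + ρ + ρ' + K ≤ lo) :
    (K : ℕ∞) ≤ setDist G X Y := by
  rcases h with h | h
  · exact hX.le_setDist_of_le hG hp hY h
  · rw [setDist_comm]
    exact hY.le_setDist_of_le hG hp hX (by omega)

/-- The complete graph on four vertices minus an edge. -/
def diamond : SimpleGraph (Fin 4) where
  Adj i j := i ≠ j ∧ s(i, j) ≠ s(1, 3)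
  symm := ⟨fun i j h => ⟨h.1.symm, by rw [Sym2.eq_swap]; exact h.2⟩⟩
  loopless := ⟨fun _ h => h.1 rfl⟩

theorem mem_edgeSet_diamond {e : Sym2 (Fin 4)} (he : e ∈ diamond.edgeSet) :
    e = s(0, 1) ∨ e = s(0, 2) ∨ e = s(0, 3) ∨ e = s(1, 2) ∨ e = s(2, 3) := by
  induction e with
  | h i j =>
    have h : i ≠ j ∧ s(i, j) ≠ s(1, 3) := he
    clear he
    revert i j
    decide

theorem IsFatMinor.of_injective_hom {W W' : Type*} {H : SimpleGraph W} {H' : SimpleGraph W'}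
    {K : ℕ} (f : H →g H') (hf : Function.Injective f) (h : IsFatMinor K H' G) :
    IsFatMinor K H G := by
  obtain ⟨M⟩ := h
  refine ⟨⟨fun w => M.branchSet (f w), fun e => M.branchPath (f.mapEdgeSet e),
    fun w => M.branchSet_connected _, fun e => M.branchPath_connected _, ?_, ?_, ?_, ?_⟩⟩
  · exact fun w e hwe => M.incident _ _ (Sym2.mem_map.2 ⟨w, hwe, rfl⟩)
  · exact fun w w' h => M.far_set_set _ _ (hf.ne h)
  · exact fun e e' h => M.far_path_path _ _ ((Hom.mapEdgeSet.injective f hf).ne h)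
  · intro w e h
    refine M.far_set_path _ _ fun hw => h ?_
    obtain ⟨w', hw', he⟩ := Sym2.mem_map.1 hw
    exact hf he ▸ hw'

/-- A fan with three legs that leave an isometric path at places far from each other, and whose
centre is far from that path, is a fat model of the diamond. -/
theorem isFatMinor_diamond (hG : G.Connected) {a b : V} {p : G.Walk a b} (hp : IsIsometric p)
    {K : ℕ} {z₁ z₂ z₃ : ℕ} (h12 : z₁ + 5 * K ≤ z₂) (h23 : z₂ + 5 * K ≤ z₃)
    (h3 : z₃ ≤ p.length) {q₁ q₂ q₃ : V} (hq₁ : G.dist (p.getVert z₁) q₁ ≤ K)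
    (hq₂ : G.dist (p.getVert z₂) q₂ ≤ K) (hq₃ : G.dist (p.getVert z₃) q₃ ≤ K)
    (U : G.Subgraph) (hU : U.Connected) (hU₁ : q₁ ∈ U.verts) (hU₂ : q₂ ∈ U.verts)
    (hU₃ : q₃ ∈ U.verts) (hfar : ∀ x ∈ U.verts, ∀ i ≤ p.length, K ≤ G.dist x (p.getVert i)) :
    IsFatMinor K diamond G := by
  have hseg : ∀ s t, s ≤ t → t ≤ p.length → ∃ X : G.Subgraph, X.Connected ∧
      IsNear p s t 0 X.verts ∧ (K : ℕ∞) ≤ setDist G U.verts X.verts ∧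
      ∀ i, s ≤ i → i ≤ t → p.getVert i ∈ X.verts := by
    intro s t hst ht
    obtain ⟨w, -, hw⟩ := exists_walk_segment p hst ht
    refine ⟨w.toSubgraph, w.toSubgraph_connected, ?_, ?_, ?_⟩
    · intro x hx
      rw [Walk.mem_verts_toSubgraph, hw] at hx
      obtain ⟨i, h1, h2, rfl⟩ := hx
      exact ⟨i, h1, h2, by omega, by simp⟩
    · refine le_setDist hG fun x hx y hy => ?_
      rw [Walk.mem_verts_toSubgraph, hw] at hy
      obtain ⟨i, h1, h2, rfl⟩ := hy
      exact hfar x hx i (by omega)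
    · intro i h1 h2
      rw [Walk.mem_verts_toSubgraph, hw]
      exact ⟨i, h1, h2, rfl⟩
  have hleg : ∀ z ≤ p.length, ∀ q, G.dist (p.getVert z) q ≤ K → ∃ X : G.Subgraph, X.Connected ∧
      IsNear p z z K X.verts ∧ p.getVert z ∈ X.verts ∧ q ∈ X.verts := by
    intro z hz q hq
    classical
    obtain ⟨w, hw⟩ := hG.exists_walk_length_eq_dist (p.getVert z) q
    refine ⟨w.toSubgraph, w.toSubgraph_connected, ?_, by simp, by simp⟩
    intro x hx
    rw [Walk.mem_verts_toSubgraph] at hx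
    refine ⟨z, le_rfl, le_rfl, hz, ?_⟩
    rw [dist_comm]
    exact (dist_le (w.takeUntil x hx)).trans
      ((w.length_takeUntil_le_length hx).trans (hw.trans_le hq))
  -- `U` models vertex 0 and `A`, `B`, `C` model 1, 2, 3; `D`, `E` are the edges along `p` and `L₁`,
  -- `L₂`, `L₃` the edges at the hub. The margin `2 * K` keeps a leg of radius `K` at distance `K`
  -- from `D` and `E`; the gap `5 * K` leaves at least `K` between consecutive branch sets.
  obtain ⟨A, hAc, hAn, hAU, hAm⟩ := hseg z₁ (z₁ + 2 * K) (by omega) (by omega)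
  obtain ⟨B, hBc, hBn, hBU, hBm⟩ := hseg (z₂ - 2 * K) (z₂ + 2 * K) (by omega) (by omega)
  obtain ⟨C, hCc, hCn, hCU, hCm⟩ := hseg (z₃ - 2 * K) z₃ (by omega) (by omega)
  obtain ⟨D, hDc, hDn, hDU, hDm⟩ := hseg (z₁ + 2 * K) (z₂ - 2 * K) (by omega) (by omega)
  obtain ⟨E, hEc, hEn, hEU, hEm⟩ := hseg (z₂ + 2 * K) (z₃ - 2 * K) (by omega) (by omega)
  obtain ⟨L₁, hc₁, hn₁, hz₁, hl₁⟩ := hleg z₁ (by omega) q₁ hq₁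
  obtain ⟨L₂, hc₂, hn₂, hz₂, hl₂⟩ := hleg z₂ (by omega) q₂ hq₂
  obtain ⟨L₃, hc₃, hn₃, hz₃, hl₃⟩ := hleg z₃ (by omega) q₃ hq₃
  obtain ⟨Q, hQ₁, hQ₂, hQ₃, hQD, hQE⟩ : ∃ Q : Sym2 (Fin 4) → G.Subgraph, Q s(0, 1) = L₁ ∧
      Q s(0, 2) = L₂ ∧ Q s(0, 3) = L₃ ∧ Q s(1, 2) = D ∧ Q s(2, 3) = E := by
    refine ⟨fun e => if e = s(0, 1) then L₁ else if e = s(0, 2) then L₂ else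
      if e = s(0, 3) then L₃ else if e = s(1, 2) then D else E, ?_, ?_, ?_, ?_, ?_⟩ <;> rfl
  refine ⟨⟨![U, A, B, C], fun e => Q e, ?_, ?_, ?_, ?_, ?_, ?_⟩⟩
  · intro i
    fin_cases i <;> assumption
  · rintro ⟨e, he⟩
    rcases mem_edgeSet_diamond he with rfl | rfl | rfl | rfl | rfl <;> simp only [*]
  · rintro w ⟨e, he⟩ hwe
    rcases mem_edgeSet_diamond he with rfl | rfl | rfl | rfl | rfl <;>
      rcases Sym2.mem_iff.1 hwe with rfl | rfl <;> simp only [hQ₁, hQ₂, hQ₃, hQD, hQE]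
    · exact ⟨q₁, hU₁, hl₁⟩
    · exact ⟨_, hAm z₁ (by omega) (by omega), hz₁⟩
    · exact ⟨q₂, hU₂, hl₂⟩
    · exact ⟨_, hBm z₂ (by omega) (by omega), hz₂⟩
    · exact ⟨q₃, hU₃, hl₃⟩
    · exact ⟨_, hCm z₃ (by omega) (by omega), hz₃⟩
    · exact ⟨_, hAm (z₁ + 2 * K) (by omega) (by omega), hDm _ (by omega) (by omega)⟩
    · exact ⟨_, hBm (z₂ - 2 * K) (by omega) (by omega), hDm _ (by omega) (by omega)⟩
    · exact ⟨_, hBm (z₂ + 2 * K) (by omega) (by omega), hEm _ (by omega) (by omega)⟩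
    · exact ⟨_, hCm (z₃ - 2 * K) (by omega) (by omega), hEm _ (by omega) (by omega)⟩
  · intro i j hij
    fin_cases i <;> fin_cases j <;>
      first
      | exact absurd rfl hij
      | assumption
      | (rw [setDist_comm]; assumption)
      | exact IsNear.le_setDist hG hp hAn hBn (by omega)
      | exact IsNear.le_setDist hG hp hAn hCn (by omega)
      | exact IsNear.le_setDist hG hp hBn hAn (by omega)
      | exact IsNear.le_setDist hG hp hBn hCn (by omega)
      | exact IsNear.le_setDist hG hp hCn hAn (by omega)
      | exact IsNear.le_setDist hG hp hCn hBn (by omega)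
  · rintro ⟨e, he⟩ ⟨e', he'⟩ hne
    rcases mem_edgeSet_diamond he with rfl | rfl | rfl | rfl | rfl <;>
      rcases mem_edgeSet_diamond he' with rfl | rfl | rfl | rfl | rfl <;>
      first
      | exact absurd rfl hne
      | (simp only [hQ₁, hQ₂, hQ₃, hQD, hQE]
         exact IsNear.le_setDist hG hp (by assumption) (by assumption) (by omega))
  · rintro w ⟨e, he⟩ hwe
    rcases mem_edgeSet_diamond he with rfl | rfl | rfl | rfl | rfl <;> fin_cases w <;>
      first
      | exact absurd (Sym2.mem_iff.2 (.inl rfl)) hwe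
      | exact absurd (Sym2.mem_iff.2 (.inr rfl)) hwe
      | (simp only [hQ₁, hQ₂, hQ₃, hQD, hQE]
         first
         | assumption
         | exact IsNear.le_setDist hG hp hAn (by assumption) (by omega)
         | exact IsNear.le_setDist hG hp hBn (by assumption) (by omega)
         | exact IsNear.le_setDist hG hp hCn (by assumption) (by omega))

end FatDiamond

/-! ### The bound on the complexity without a fat diamond. -/

section Bounded

variable {V : Type u} {G : SimpleGraph V}

/-- A walk which leaves a set of vertices does so for a first time. -/
theorem exists_first_exit (S : Set V) {u v : V} (g : G.Walk u v) (hu : u ∈ S) (hv : v ∉ S) :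
    ∃ (q q' : V) (g₁ : G.Walk u q) (g₂ : G.Walk q' v), G.Adj q q' ∧ q' ∉ S ∧
      (∀ x ∈ g₁.support, x ∈ S) ∧ g₁.length + 1 + g₂.length = g.length := by
  induction g with
  | nil => exact absurd hu hv
  | @cons u w v h g ih =>
    by_cases hw : w ∈ S
    · obtain ⟨q, q', g₁, g₂, h1, h2, h3, h4⟩ := ih hw hv
      refine ⟨q, q', .cons h g₁, g₂, h1, h2, ?_, ?_⟩
      · intro x hx
        rw [Walk.support_cons, List.mem_cons] at hx
        rcases hx with rfl | hx
        · exact hu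
        · exact h3 x hx
      · rw [Walk.length_cons, Walk.length_cons]
        omega
    · refine ⟨u, w, .nil, g, h, hw, by simpa using hu, ?_⟩
      rw [Walk.length_cons, Walk.length_nil]
      omega

/-- Every vertex of a path far from `r` is joined to the path by a leg, through which a shortest
path from `r` passes. -/
theorem exists_leg (hG : G.Connected) (r : V) {a b : V} (p : G.Walk a b) {K : ℕ} (hK : 1 ≤ K)
    (hr : ∀ i ≤ p.length, K ≤ G.dist r (p.getVert i)) {y : ℕ} (hy : y ≤ p.length) :
    ∃ z ≤ p.length, ∃ (q : V) (g : G.Walk r q), G.dist (p.getVert z) q ≤ K ∧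
      (∀ x ∈ g.support, ∀ i ≤ p.length, K ≤ G.dist x (p.getVert i)) ∧
      G.dist r (p.getVert z) + G.dist (p.getVert z) (p.getVert y) ≤
        G.dist r (p.getVert y) + 2 * K := by
  obtain ⟨g, hg⟩ := hG.exists_walk_length_eq_dist r (p.getVert y)
  obtain ⟨q, q', g₁, g₂, h1, h2, h3, h4⟩ :=
    exists_first_exit {x | ∀ i ≤ p.length, K ≤ G.dist x (p.getVert i)} g hr (fun h => by
      have := h y hy
      rw [dist_self] at this
      omega)
  simp only [Set.mem_ofPred_eq, not_forall, not_le] at h2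
  obtain ⟨z, hz, hzK⟩ := h2
  have h5 := dist_le g₁
  have h6 := dist_le (g₂.cons h1)
  rw [Walk.length_cons] at h6
  have h7 : G.dist q q' = 1 := dist_eq_one_iff_adj.2 h1
  have h8 := hG.dist_triangle (u := q) (v := q') (w := p.getVert z)
  -- A detour from `q` to the vertex with index `z` and back costs at most `2 * K`.
  have h9 := hG.dist_triangle (u := r) (v := q) (w := p.getVert z)
  have h10 := hG.dist_triangle (u := p.getVert z) (v := q) (w := p.getVert y)
  have h11 : G.dist (p.getVert z) q = G.dist q (p.getVert z) := dist_comm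
  exact ⟨z, hz, q, g₁, by omega, h3, by omega⟩

/-- The slack `2 * K` of a leg is beaten by `2 * K + 1` defects. Two targets `9 * K + 2 = (2 * K +
1) + 5 * K + (2 * K + 1)` defects apart thus have feet at least `5 * K` apart, and three targets use
`18 * K + 4` defects. -/
theorem isCoverableFrom_of_not_isFatMinor (hG : G.Connected) {K : ℕ} (hK : 1 ≤ K)
    (hM : ¬ IsFatMinor K diamond G) (r : V) {a b : V} (p : G.Walk a b) (hp : IsIsometric p) :
    IsCoverableFrom r (18 * K + 4) p := by
  refine (isCoverableFrom_or_defects hG r p (18 * K + 4)).resolve_right ?_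
  rintro ⟨x, hxm, hx⟩
  have hmono : ∀ i j, i ≤ j → j ≤ 18 * K + 4 → x i + (j - i) ≤ x j := by
    intro i j hij hj
    have := defects_add hx hij hj
    omega
  have hlen : ∀ i ≤ 18 * K + 4, x i ≤ p.length := by
    intro i hi
    have := hmono i _ hi le_rfl
    omega
  have hup : ∀ c z, c + 2 * K + 1 ≤ 18 * K + 4 → z ≤ p.length →
      G.dist r (p.getVert z) + G.dist (p.getVert z) (p.getVert (x c)) ≤
        G.dist r (p.getVert (x c)) + 2 * K → z < x (c + 2 * K + 1) := by
    intro c z hc hz h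
    by_contra! hlt
    have h1 := defects_add hx (show c ≤ c + 2 * K + 1 by omega) hc
    have h2 := hmono c (c + 2 * K + 1) (by omega) hc
    have h3 := hp.dist_getVert hG hlt hz
    have h4 := hp.dist_getVert hG (show x c ≤ z by omega) hz
    have h5 := hG.dist_triangle (u := r) (v := p.getVert z) (w := p.getVert (x (c + 2 * K + 1)))
    rw [dist_comm] at h4
    rw [dist_comm (u := p.getVert z) (v := p.getVert (x (c + 2 * K + 1)))] at h5
    push_cast at h1
    omega
  have hdown : ∀ c z, c + 2 * K + 1 ≤ 18 * K + 4 → z ≤ p.length →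
      G.dist r (p.getVert z) +
        G.dist (p.getVert z) (p.getVert (x (c + 2 * K + 1))) ≤
        G.dist r (p.getVert (x (c + 2 * K + 1))) + 2 * K → x c < z := by
    intro c z hc hz h
    by_contra! hlt
    have h1 := defects_add hx (show c ≤ c + 2 * K + 1 by omega) hc
    have h2 := hmono c (c + 2 * K + 1) (by omega) hc
    have h3 := hp.dist_getVert hG hlt (hlen c (by omega))
    have h4 := hp.dist_getVert hG (show z ≤ x (c + 2 * K + 1) by omega) (hlen _ hc)
    have h5 := hG.dist_triangle (u := r) (v := p.getVert z) (w := p.getVert (x c))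
    push_cast at h1
    omega
  have hsep : ∀ c z z', c + 9 * K + 2 ≤ 18 * K + 4 → z ≤ p.length → z' ≤ p.length →
      G.dist r (p.getVert z) + G.dist (p.getVert z) (p.getVert (x c)) ≤
        G.dist r (p.getVert (x c)) + 2 * K →
      G.dist r (p.getVert z') + G.dist (p.getVert z') (p.getVert (x (c + 9 * K + 2))) ≤
        G.dist r (p.getVert (x (c + 9 * K + 2))) + 2 * K → z + 5 * K ≤ z' := by
    intro c z z' hc hz hz' h h'
    rw [show c + 9 * K + 2 = (c + 7 * K + 1) + 2 * K + 1 by omega] at h'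
    have h1 := hup c z (by omega) hz h
    have h2 := hdown (c + 7 * K + 1) z' (by omega) hz' h'
    have h3 := hmono (c + 2 * K + 1) (c + 7 * K + 1) (by omega) (by omega)
    omega
  by_cases hr : ∀ i ≤ p.length, K ≤ G.dist r (p.getVert i)
  · obtain ⟨z₁, hz₁, q₁, g₁, hq₁, hg₁, h₁⟩ := exists_leg hG r p hK hr (hlen 0 (by omega))
    obtain ⟨z₂, hz₂, q₂, g₂, hq₂, hg₂, h₂⟩ :=
      exists_leg hG r p hK hr (hlen (0 + 9 * K + 2) (by omega))
    obtain ⟨z₃, hz₃, q₃, g₃, hq₃, hg₃, h₃⟩ :=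
      exists_leg hG r p hK hr (hlen ((0 + 9 * K + 2) + 9 * K + 2) (by omega))
    refine hM (isFatMinor_diamond hG hp (hsep 0 z₁ z₂ (by omega) hz₁ hz₂ h₁ h₂)
      (hsep _ z₂ z₃ (by omega) hz₂ hz₃ h₂ h₃) hz₃ hq₁ hq₂ hq₃
      -- The hub is one walk running through all three initial parts, returning to `r` in between.
      (g₁.reverse.append (g₂.append (g₂.reverse.append g₃))).toSubgraph
      (Walk.toSubgraph_connected _) ?_ ?_ ?_ ?_)
    · simp
    · simp
    · simp
    · intro x hx
      simp only [Walk.mem_verts_toSubgraph, Walk.mem_support_append_iff, Walk.support_reverse,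
        List.mem_reverse] at hx
      rcases hx with hx | hx | hx | hx
      exacts [hg₁ x hx, hg₂ x hx, hg₂ x hx, hg₃ x hx]
  · push Not at hr
    obtain ⟨z, hz, hzK⟩ := hr
    -- A path vertex closer than `K` to `r` serves as foot for every target, so it would be
    -- separated from itself.
    have hnear : ∀ y, G.dist r (p.getVert z) + G.dist (p.getVert z) (p.getVert y) ≤
        G.dist r (p.getVert y) + 2 * K := by
      intro y
      have h1 := hG.dist_triangle (u := p.getVert z) (v := r) (w := p.getVert y)
      rw [dist_comm (u := p.getVert z) (v := r)] at h1
      omega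
    have := hsep 0 z z (by omega) hz hz (hnear _) (hnear _)
    omega

theorem strongIsometricPathComplexity_le (hG : G.Connected) {K : ℕ} (hK : 1 ≤ K)
    (hM : ¬ IsFatMinor K diamond G) :
    strongIsometricPathComplexity G ≤ ((18 * K + 4 : ℕ) : ℕ∞) :=
  iInf₂_le (18 * K + 4) fun r _ _ p hp => isCoverableFrom_of_not_isFatMinor hG hK hM r p hp

end Bounded

/-! ### Embedding small graphs in the diamond. -/

theorem exists_injective_hom_diamond {W : Type v} [Finite W] (H : SimpleGraph W)
    (hH : Nat.card W ≤ 4) (h : ¬ Nonempty (H ≃g completeGraph (Fin 4))) :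
    ∃ f : H →g diamond, Function.Injective f := by
  rcases Nat.lt_or_ge (Nat.card W) 4 with hlt | hge
  -- The vertices 0, 1, 2 of the diamond span a triangle, which accommodates any graph on three
  -- vertices.
  · let g : W ↪ Fin 3 := (Finite.equivFin W).toEmbedding.trans (Fin.castLEEmb (by omega))
    have hg : Function.Injective (Fin.castSucc ∘ g) :=
      (Fin.castSucc_injective 3).comp g.injective
    refine ⟨⟨Fin.castSucc ∘ g, fun {x y} hxy => ⟨hg.ne hxy.ne, ?_⟩⟩, hg⟩
    intro he
    have h3 : (3 : Fin 4) ∈ s((g x).castSucc, (g y).castSucc) := he ▸ Sym2.mem_mk_right _ _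
    rcases Sym2.mem_iff.1 h3 with h | h <;> exact Fin.castSucc_ne_last _ h.symm
  · obtain ⟨a, b, hab, hnadj⟩ : ∃ a b, a ≠ b ∧ ¬ H.Adj a b := by
      by_contra! hc
      refine h ⟨⟨Finite.equivFinOfCardEq (le_antisymm hH hge), fun {x y} => ?_⟩⟩
      rw [completeGraph_eq_top, top_adj, (Finite.equivFinOfCardEq _).injective.ne_iff]
      exact ⟨hc x y, fun h => h.ne⟩
    -- A non-adjacent pair is moved onto the missing edge; the second swap fixes 1.
    let e₀ : W ≃ Fin 4 := Finite.equivFinOfCardEq (le_antisymm hH hge)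
    let e₁ : W ≃ Fin 4 := e₀.trans (Equiv.swap (e₀ a) 1)
    have ha₁ : e₁ a = 1 := by simp [e₁]
    have hb₁ : e₁ b ≠ 1 := ha₁ ▸ e₁.injective.ne hab.symm
    let e : W ≃ Fin 4 := e₁.trans (Equiv.swap (e₁ b) 3)
    have ha : e a = 1 := by
      simp only [e, Equiv.trans_apply, ha₁]
      exact Equiv.swap_apply_of_ne_of_ne hb₁.symm (by decide)
    have hb : e b = 3 := by simp [e]
    refine ⟨⟨e, fun {x y} hxy => ⟨e.injective.ne hxy.ne, ?_⟩⟩, e.injective⟩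
    rw [← ha, ← hb]
    intro he
    rcases Sym2.eq_iff.1 he with ⟨h1, h2⟩ | ⟨h1, h2⟩
    · exact hnadj (e.injective h1 ▸ e.injective h2 ▸ hxy)
    · exact hnadj (e.injective h1 ▸ e.injective h2 ▸ hxy.symm)

/-! ### Fat minors in graphs that a vertex deletion makes acyclic. -/

section Trees

variable {V : Type u} {G T : SimpleGraph V}

/-- A graph is acyclic if there is a height function for which every vertex has at most one
neighbour that is not higher. -/
theorem isAcyclic_of_height (h : V → ℕ)
    (hT : ∀ x y z, T.Adj x y → T.Adj x z → h y ≤ h x → h z ≤ h x → y = z) : T.IsAcyclic := by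
  classical
  intro v c hc
  obtain ⟨x, hx, hmax⟩ := c.support.toFinset.exists_max_image h ⟨v, by simp⟩
  rw [List.mem_toFinset] at hx
  have hd := hc.rotate hx
  have hs : ∀ y ∈ (c.rotate x hx).support, h y ≤ h x := fun y hy =>
    hmax y (List.mem_toFinset.2 ((Walk.mem_support_rotate_iff c _ hx).1 hy))
  exact hd.snd_ne_penultimate (hT x _ _ ((c.rotate x hx).adj_snd hd.not_nil)
    ((c.rotate x hx).adj_penultimate hd.not_nil).symm
    (hs _ (Walk.getVert_mem_support _ _)) (hs _ (Walk.getVert_mem_support _ _)))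

theorem exists_walk_of_connected {r : V} (hT : ∀ x y, G.Adj x y → x ≠ r → y ≠ r → T.Adj x y)
    {B : G.Subgraph} (hB : B.Connected) (hr : r ∉ B.verts) {x y : V} (hx : x ∈ B.verts)
    (hy : y ∈ B.verts) : ∃ w : T.Walk x y, ∀ z ∈ w.support, z ∈ B.verts := by
  let f : B.coe →g T := ⟨Subtype.val, fun {a b} hab => hT _ _ (B.adj_sub hab)
    (fun h => hr (h ▸ a.2)) (fun h => hr (h ▸ b.2))⟩
  obtain ⟨w⟩ := hB.coe.preconnected ⟨x, hx⟩ ⟨y, hy⟩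
  refine ⟨w.map f, fun z hz => ?_⟩
  rw [Walk.support_map, List.mem_map] at hz
  obtain ⟨a, -, rfl⟩ := hz
  exact a.2

theorem not_mem_of_setDist {K : ℕ} (hK : 1 ≤ K) {S S' : Set V}
    (h : (K : ℕ∞) ≤ setDist G S S') {x : V} (hx : x ∈ S) : x ∉ S' := by
  intro hx'
  have h1 : setDist G S S' ≤ G.edist x x := iInf₂_le_of_le x hx (iInf₂_le x hx')
  have h2 := h.trans h1
  rw [edist_self] at h2
  have : K = 0 := by exact_mod_cast le_antisymm h2 bot_le
  omega

theorem not_adj_of_setDist {K : ℕ} (hK : 2 ≤ K) {S S' : Set V}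
    (h : (K : ℕ∞) ≤ setDist G S S') {x y : V} (hx : x ∈ S) (hy : y ∈ S') : ¬ G.Adj x y := by
  intro hxy
  have h1 : setDist G S S' ≤ G.edist x y := iInf₂_le_of_le x hx (iInf₂_le y hy)
  have h2 := h.trans h1
  rw [edist_eq_one_iff_adj.2 hxy] at h2
  have : K ≤ 1 := by exact_mod_cast h2
  omega

/-- A graph that becomes acyclic by deleting the vertex `r` has no fat triangle that avoids `r`. -/
theorem not_fat_triangle {r : V} (hT : T.IsAcyclic) (hTG : T ≤ G)
    (hGT : ∀ x y, G.Adj x y → x ≠ r → y ≠ r → T.Adj x y)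
    {A B C P Q R : G.Subgraph} (hA : A.Connected) (hB : B.Connected) (hC : C.Connected)
    (hP : P.Connected) (hQ : Q.Connected) (hR : R.Connected)
    (hrA : r ∉ A.verts) (hrB : r ∉ B.verts) (hrC : r ∉ C.verts)
    (hrP : r ∉ P.verts) (hrQ : r ∉ Q.verts) (hrR : r ∉ R.verts)
    (hAP : (A.verts ∩ P.verts).Nonempty) (hBP : (B.verts ∩ P.verts).Nonempty)
    (hBQ : (B.verts ∩ Q.verts).Nonempty) (hCQ : (C.verts ∩ Q.verts).Nonempty)
    (hAR : (A.verts ∩ R.verts).Nonempty) (hCR : (C.verts ∩ R.verts).Nonempty)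
    (hAC : ((2 : ℕ) : ℕ∞) ≤ setDist G A.verts C.verts)
    (hBR : ((2 : ℕ) : ℕ∞) ≤ setDist G B.verts R.verts)
    (hPR : ((2 : ℕ) : ℕ∞) ≤ setDist G P.verts R.verts)
    (hQR : ((2 : ℕ) : ℕ∞) ≤ setDist G Q.verts R.verts) : False := by
  classical
  obtain ⟨x, hxA, hxR⟩ := hAR
  obtain ⟨y, hyC, hyR⟩ := hCR
  obtain ⟨a, haA, haP⟩ := hAP
  obtain ⟨b, hbB, hbP⟩ := hBP
  obtain ⟨c, hcB, hcQ⟩ := hBQ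
  obtain ⟨d, hdC, hdQ⟩ := hCQ
  obtain ⟨w₀, h₀⟩ := exists_walk_of_connected hGT hR hrR hxR hyR
  obtain ⟨w₁, h₁⟩ := exists_walk_of_connected hGT hA hrA hxA haA
  obtain ⟨w₂, h₂⟩ := exists_walk_of_connected hGT hP hrP haP hbP
  obtain ⟨w₃, h₃⟩ := exists_walk_of_connected hGT hB hrB hbB hcB
  obtain ⟨w₄, h₄⟩ := exists_walk_of_connected hGT hQ hrQ hcQ hdQ
  obtain ⟨w₅, h₅⟩ := exists_walk_of_connected hGT hC hrC hdC hyC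
  let w := w₁.append (w₂.append (w₃.append (w₄.append w₅)))
  -- Paths in a forest are unique, so the route through `R` and the route through `A`, `P`, `B`,
  -- `Q`, `C` reduce to the same path. It stays in `R`, hence in `A ∪ C`, and must use an edge from
  -- `A` to `C`.
  have heq : w₀.bypass = w.bypass :=
    congrArg Subtype.val ((hT.subsingleton_path x y).elim
      ⟨_, w₀.bypass_isPath⟩ ⟨_, w.bypass_isPath⟩)
  have hmem : ∀ z ∈ w₀.bypass.support, z ∈ A.verts ∨ z ∈ C.verts := by
    intro z hz
    have hzR : z ∈ R.verts := h₀ z (w₀.support_bypass_subset_support hz)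
    rw [heq] at hz
    have hzw := w.support_bypass_subset_support hz
    simp only [w, Walk.mem_support_append_iff] at hzw
    rcases hzw with h | h | h | h | h
    · exact Or.inl (h₁ z h)
    · exact absurd hzR (not_mem_of_setDist (by omega) hPR (h₂ z h))
    · exact absurd hzR (not_mem_of_setDist (by omega) hBR (h₃ z h))
    · exact absurd hzR (not_mem_of_setDist (by omega) hQR (h₄ z h))
    · exact Or.inr (h₅ z h)
  obtain ⟨e, he, h1, h2⟩ := w₀.bypass.exists_boundary_dart A.verts hxA
    (fun h => not_mem_of_setDist (by omega) hAC h hyC)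
  have h3 := (hmem e.snd (w₀.bypass.dart_snd_mem_support_of_mem_darts he)).resolve_left h2
  exact not_adj_of_setDist le_rfl hAC h1 h3 (hTG e.adj)

/-- A graph that becomes acyclic by deleting a vertex has no 2-fat `K₄` minor. -/
theorem not_isFatMinor_of_isAcyclic {W : Type v} {H : SimpleGraph W}
    (e : H ≃g completeGraph (Fin 4)) {r : V} (hT : T.IsAcyclic) (hTG : T ≤ G)
    (hGT : ∀ x y, G.Adj x y → x ≠ r → y ≠ r → T.Adj x y) : ¬ IsFatMinor 2 H G := by
  intro hM
  obtain ⟨M⟩ : IsFatMinor 2 (completeGraph (Fin 4)) G :=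
    hM.of_injective_hom e.symm.toHom e.symm.injective
  -- Discarding `i` removes every part that may contain `r`: take the branch set containing `r`, or
  -- else an end of the edge whose branch path does.
  obtain ⟨i, hi, hi'⟩ : ∃ i : Fin 4, (∀ j, j ≠ i → r ∉ (M.branchSet j).verts) ∧
      ∀ f : (completeGraph (Fin 4)).edgeSet, i ∉ (f : Sym2 (Fin 4)) →
        r ∉ (M.branchPath f).verts := by
    by_cases h : ∃ i, r ∈ (M.branchSet i).verts
    · obtain ⟨i, hi⟩ := h
      exact ⟨i, fun j hj => not_mem_of_setDist (by omega) (M.far_set_set i j hj.symm) hi,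
        fun f hf => not_mem_of_setDist (by omega) (M.far_set_path i f hf) hi⟩
    · push Not at h
      by_cases h' : ∃ f, r ∈ (M.branchPath f).verts
      · obtain ⟨f, hf⟩ := h'
        refine ⟨(f : Sym2 (Fin 4)).out.1, fun j _ => h j, fun f' hf' => ?_⟩
        refine not_mem_of_setDist (by omega) (M.far_path_path f f' ?_) hf
        rintro rfl
        exact hf' (Sym2.out_fst_mem _)
      · push Not at h'
        exact ⟨0, fun j _ => h j, fun f _ => h' f⟩
  obtain ⟨a, b, c, hai, hbi, hci, hab, hac, hbc⟩ : ∃ a b c : Fin 4, a ≠ i ∧ b ≠ i ∧ c ≠ i ∧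
      a ≠ b ∧ a ≠ c ∧ b ≠ c := by
    clear hi hi'
    revert i
    decide
  let edge (x y : Fin 4) (hxy : x ≠ y) : (completeGraph (Fin 4)).edgeSet := ⟨s(x, y), hxy⟩
  have hr : ∀ x y hxy, x ≠ i → y ≠ i → r ∉ (M.branchPath (edge x y hxy)).verts := by
    intro x y hxy hx hy
    exact hi' _ fun h => (Sym2.mem_iff.1 h).elim hx.symm hy.symm
  have hfar : ∀ x y z hxy, z ≠ x → z ≠ y → ((2 : ℕ) : ℕ∞) ≤
      setDist G (M.branchSet z).verts (M.branchPath (edge x y hxy)).verts := by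
    intro x y z hxy hx hy
    exact M.far_set_path _ _ fun h => (Sym2.mem_iff.1 h).elim hx hy
  have hfar' : ∀ x y z t hxy hzt, x ≠ z → x ≠ t → ((2 : ℕ) : ℕ∞) ≤
      setDist G (M.branchPath (edge x y hxy)).verts (M.branchPath (edge z t hzt)).verts := by
    intro x y z t hxy hzt hx hy
    refine M.far_path_path _ _ fun h => ?_
    have h' : s(x, y) = s(z, t) := congrArg Subtype.val h
    have : x ∈ s(z, t) := h' ▸ Sym2.mem_mk_left x y
    exact (Sym2.mem_iff.1 this).elim hx hy
  exact not_fat_triangle hT hTG hGT (M.branchSet_connected a) (M.branchSet_connected b)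
    -- The order `edge b a` puts first the end that is not on the edge `a c`, as `hfar'` requires.
    (M.branchSet_connected c) (M.branchPath_connected (edge b a hab.symm))
    (M.branchPath_connected (edge b c hbc)) (M.branchPath_connected (edge a c hac))
    (hi a hai) (hi b hbi) (hi c hci) (hr _ _ _ hbi hai) (hr _ _ _ hbi hci) (hr _ _ _ hai hci)
    (M.incident _ _ (Sym2.mem_mk_right _ _)) (M.incident _ _ (Sym2.mem_mk_left _ _))
    (M.incident _ _ (Sym2.mem_mk_left _ _)) (M.incident _ _ (Sym2.mem_mk_right _ _))
    (M.incident _ _ (Sym2.mem_mk_left _ _)) (M.incident _ _ (Sym2.mem_mk_right _ _))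
    (M.far_set_set _ _ hac) (hfar _ _ _ _ hab.symm hbc) (hfar' _ _ _ _ _ _ hab.symm hbc)
    (hfar' _ _ _ _ _ _ hab.symm hbc)

end Trees

/-! ### Lower bound from equidistant isometric paths. -/

section Equidistant

variable {V : Type u} {G : SimpleGraph V}

/-- An isometric path whose vertices are all at the same distance from `r` needs one `r`-rooted
isometric path for each vertex. -/
theorem length_lt_of_isCoverableFrom (hG : G.Connected) {r a b : V} {p : G.Walk a b}
    (hp : IsIsometric p) {L k : ℕ} (hL : ∀ x ∈ p.support, G.dist r x = L)
    (h : IsCoverableFrom r k p) : p.length < k := by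
  obtain ⟨e, q, hq, hc⟩ := h
  have hi : ∀ n : Fin (p.length + 1), ∃ i, p.getVert n ∈ (q i).support := fun n =>
    hc _ (p.getVert_mem_support _)
  choose g hg using hi
  have hinj : Function.Injective g := by
    intro m n hmn
    -- A shortest path from `r` has only one vertex at distance `L`, the one with index `L`.
    have key : ∀ i, ∀ x ∈ (q i).support, x ∈ p.support → x = (q i).getVert L := by
      intro i x hx hxp
      obtain ⟨j, rfl, hj⟩ := Walk.mem_support_iff_exists_getVert.1 hx
      have h1 := (hq i).dist_getVert hG (Nat.zero_le j) hj
      rw [Walk.getVert_zero, hL _ hxp] at h1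
      rw [h1, Nat.sub_zero]
    have h1 := key _ _ (hg m) (p.getVert_mem_support _)
    have h2 := key _ _ (hg n) (p.getVert_mem_support _)
    rw [hmn, ← h2] at h1
    have := hp.1.getVert_injOn (show (m : ℕ) ≤ p.length by omega)
      (show (n : ℕ) ≤ p.length by omega) h1
    exact Fin.ext this
  have := Fintype.card_le_of_injective g hinj
  simpa using this

theorem length_add_one_le_strongIsometricPathComplexity (hG : G.Connected) {r a b : V}
    {p : G.Walk a b} (hp : IsIsometric p) {L : ℕ} (hL : ∀ x ∈ p.support, G.dist r x = L) :
    (p.length : ℕ∞) + 1 ≤ strongIsometricPathComplexity G := by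
  refine le_iInf₂ fun k hk => ?_
  have := length_lt_of_isCoverableFrom hG hp hL (hk r a b p hp)
  exact_mod_cast this

end Equidistant

/-! ### Lower bounds on distances from 1-Lipschitz functions. -/

section Lipschitz

variable {V : Type u} {G : SimpleGraph V}

theorem le_add_dist_of_lipschitz (hG : G.Connected) (h : V → ℕ)
    (hh : ∀ x y, G.Adj x y → h x ≤ h y + 1) (x y : V) : h x ≤ h y + G.dist x y := by
  obtain ⟨w, hw⟩ := hG.exists_walk_length_eq_dist x y
  rw [← hw]
  clear hw
  induction w with
  | nil => simp
  | cons hxy w ih =>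
    have := hh _ _ hxy
    rw [Walk.length_cons]
    omega

end Lipschitz

/-! ### The subdivided fans. -/

/-- The vertices of a fan: a path of `n + 1` vertices in row `0`, each of them the lower end of a
column, and a centre in row `n + 1`. -/
@[ext]
structure FanVertex (n : ℕ) : Type u where
  /-- the column -/
  col : ℕ
  /-- the row -/
  row : ℕ
  col_le : col ≤ n
  row_le : row ≤ n + 1
  centre : row = n + 1 → col = 0

namespace FanVertex

variable {n : ℕ}

instance : Finite (FanVertex.{u} n) := by
  refine Finite.of_injective (β := Fin (n + 1) × Fin (n + 2))
    (fun x => (⟨x.col, Nat.lt_succ_of_le x.col_le⟩, ⟨x.row, Nat.lt_succ_of_le x.row_le⟩))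
    fun x y h => ?_
  simp only [Prod.mk.injEq, Fin.mk.injEq] at h
  exact FanVertex.ext h.1 h.2

/-- The relation that joins a vertex to the next one in its column or in row `0`. -/
def Next (x y : FanVertex.{u} n) : Prop :=
  (x.row + 1 = y.row ∧ (x.col = y.col ∨ y.row = n + 1)) ∨
    (x.row = 0 ∧ y.row = 0 ∧ x.col + 1 = y.col)

/-- The subdivided fan. -/
def fan (n : ℕ) : SimpleGraph (FanVertex.{u} n) where
  Adj x y := Next x y ∨ Next y x
  symm := ⟨fun _ _ h => h.symm⟩
  loopless := ⟨fun x h => by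
    simp only [Next] at h
    omega⟩

/-- The subdivided fan without the edges at the centre. -/
def comb (n : ℕ) : SimpleGraph (FanVertex.{u} n) where
  Adj x y := (fan n).Adj x y ∧ x.row ≤ n ∧ y.row ≤ n
  symm := ⟨fun _ _ h => ⟨h.1.symm, h.2.2, h.2.1⟩⟩
  loopless := ⟨fun _ h => h.1.ne rfl⟩

/-- With height `col + row`, the only neighbour not higher is the one below in the column or, in row
0, the one to the left. -/
theorem comb_isAcyclic : (comb.{u} n).IsAcyclic := by
  refine isAcyclic_of_height (fun x => x.col + x.row) fun x y z hy hz h1 h2 => ?_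
  simp only [comb, fan, Next] at hy hz
  ext <;> omega

/-- The centre of the fan. -/
def root (n : ℕ) : FanVertex.{u} n := ⟨0, n + 1, Nat.zero_le n, le_rfl, fun _ => rfl⟩

/-- The vertices of the path of the fan. -/
def base (n i : ℕ) (hi : i ≤ n) : FanVertex.{u} n := ⟨i, 0, hi, Nat.zero_le _, by simp⟩

theorem exists_walk_base (x : FanVertex.{u} n) (hx : x.row ≤ n) :
    ∃ w : (fan.{u} n).Walk (root n) x, w.length + x.row = n + 1 := by
  obtain ⟨i, j, hi, hj, hc⟩ := x
  simp only at hx ⊢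
  obtain ⟨d, hd⟩ : ∃ d, j + d = n := ⟨n - j, by omega⟩
  induction d generalizing j with
  | zero =>
    have : (fan.{u} n).Adj (root n) ⟨i, j, hi, hj, hc⟩ :=
      Or.inr (Or.inl ⟨by simp only [root]; omega, Or.inr rfl⟩)
    exact ⟨this.toWalk, by simp; omega⟩
  | succ d ih =>
    obtain ⟨w, hw⟩ := ih (j + 1) (by omega) (by omega) (by omega) (by omega)
    have : (fan.{u} n).Adj ⟨i, j + 1, hi, by omega, by omega⟩ ⟨i, j, hi, hj, hc⟩ :=
      Or.inr (Or.inl ⟨rfl, Or.inl rfl⟩)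
    exact ⟨w.concat this, by rw [Walk.length_concat]; omega⟩

theorem fan_connected : (fan.{u} n).Connected := by
  refine (connected_iff_exists_forall_reachable _).2 ⟨root n, fun x => ?_⟩
  rcases Nat.lt_or_ge n x.row with h | h
  · have : x = root n := by
      have h1 := x.row_le
      have h2 := x.centre
      ext <;> simp only [root] <;> omega
    rw [this]
  · exact ⟨(exists_walk_base x h).choose⟩

theorem exists_base_walk (i : ℕ) (hi : i ≤ n) :
    ∃ w : (fan.{u} n).Walk (base n 0 (Nat.zero_le n)) (base n i hi), w.length = i ∧
      ∀ x ∈ w.support, x.row = 0 := by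
  induction i with
  | zero => exact ⟨.nil, rfl, by simp [base]⟩
  | succ i ih =>
    obtain ⟨w, hw, hs⟩ := ih (by omega)
    have : (fan.{u} n).Adj (base n i (by omega)) (base n (i + 1) hi) :=
      Or.inl (Or.inr ⟨rfl, rfl, rfl⟩)
    refine ⟨w.concat this, by rw [Walk.length_concat, hw], fun x hx => ?_⟩
    rw [Walk.support_concat, List.mem_append, List.mem_singleton] at hx
    rcases hx with hx | rfl
    · exact hs x hx
    · rfl

theorem dist_root (x : FanVertex.{u} n) (hx : x.row = 0) : (fan n).dist (root n) x = n + 1 := by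
  obtain ⟨w, hw⟩ := exists_walk_base x (by omega)
  have h1 := dist_le w
  have h2 := le_add_dist_of_lipschitz fan_connected (fun x : FanVertex.{u} n => x.row)
    (fun x y h => by
      simp only [fan, Next] at h
      omega) (root n) x
  simp only [root, hx] at h2
  change n + 1 ≤ 0 + (fan n).dist (root n) x at h2
  omega

theorem le_strongIsometricPathComplexity_fan :
    (n : ℕ∞) + 1 ≤ strongIsometricPathComplexity (fan.{u} n) := by
  obtain ⟨w, hw, hs⟩ := exists_base_walk.{u} n le_rfl
  have hw' : IsIsometric w := by
    apply isIsometric_of_length_le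
    have := le_add_dist_of_lipschitz fan_connected
      -- Truncation at `n` gives the top of every column the value `n`, so the centre can also take
      -- `n` and offers no shortcut.
      (fun x : FanVertex.{u} n => if x.row = n + 1 then n else min n (x.col + x.row))
      (fun x y h => by
        have h1 := x.col_le
        have h2 := y.col_le
        simp only [fan, Next] at h
        split_ifs <;> omega) (base n n le_rfl) (base n 0 (Nat.zero_le n))
    rw [dist_comm] at this
    rw [hw]
    simpa [base] using this
  have := length_add_one_le_strongIsometricPathComplexity fan_connected hw'
    (fun x hx => dist_root x (hs x hx))
  rwa [hw] at this

theorem not_isFatMinor_fan {W : Type v} {H : SimpleGraph W} (e : H ≃g completeGraph (Fin 4)) :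
    ¬ IsFatMinor 2 H (fan.{u} n) := by
  refine not_isFatMinor_of_isAcyclic e (r := root n) comb_isAcyclic (fun x y h => h.1) ?_
  have hrow : ∀ x : FanVertex.{u} n, x ≠ root n → x.row ≤ n := by
    intro x hx
    by_contra! h
    have h1 := x.row_le
    have h2 := x.centre
    exact hx (by ext <;> simp only [root] <;> omega)
  exact fun x y h hx hy => ⟨h, hrow x hx, hrow y hy⟩

end FanVertex

end CoarseGraph

open CoarseGraph

theorem mainTheorem6 {W : Type v} [Finite W] (H : SimpleGraph W) (hH : Nat.card W ≤ 4) :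
    (∀ 𝒢 : Set CoarseGraph.FinGraph.{u}, (∀ G ∈ 𝒢, G.graph.Connected) →
        CoarseGraph.IsAsymptoticMinorFree H 𝒢 →
        CoarseGraph.HasBoundedStrongIsometricPathComplexity 𝒢) ↔
      ¬ Nonempty (H ≃g SimpleGraph.completeGraph (Fin 4)) := by
  constructor
  · rintro h ⟨e⟩
    obtain ⟨k, hk⟩ := h
      (Set.range fun n : ℕ => ⟨FanVertex.{u} n, inferInstance, FanVertex.fan n⟩)
      (by rintro _ ⟨n, rfl⟩; exact FanVertex.fan_connected)
      (fun hM => by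
        obtain ⟨_, ⟨n, rfl⟩, hG⟩ := hM 2 (by omega)
        exact FanVertex.not_isFatMinor_fan e hG)
    -- The fan with `n = k` already exceeds the supposed bound `k`.
    have h1 := FanVertex.le_strongIsometricPathComplexity_fan.{u}.trans (hk _ ⟨k, rfl⟩)
    have h2 : k + 1 ≤ k := by exact_mod_cast h1
    omega
  · intro hK 𝒢 hconn hfree
    obtain ⟨f, hf⟩ := exists_injective_hom_diamond H hH hK
    simp only [IsAsymptoticMinorFree, HasAsymptoticMinor, not_forall, not_exists, not_and] at hfree
    obtain ⟨K, hK1, hfree⟩ := hfree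
    exact ⟨18 * K + 4, fun G hG => strongIsometricPathComplexity_le (hconn G hG) hK1
      fun hM => hfree G hG (hM.of_injective_hom f hf)⟩
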